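/- Let $G$ be a finite group, let $V_1,\dots,V_k$ be a complete list of its pairwise non-isomorphic irreducible complex representations $(V_j,\rho_j)$, and fix for each $j$ a basis $B_j$ of $V_j$ that is orthonormal for some $G$-invariant Hermitian inner product. Let $X$ be a finite nonempty set on which $G$ acts transitively, let $\mathbb{C}X$ be the permutation representation with basis $\{e_x : x\in X\}$ and $e_g\cdot e_x=e_{g(x)}$, and let $m(V_j,\mathbb{C}X)$ be the multiplicities, i.e. $\mathbb{C}X\cong\bigoplus_j V_j^{m(V_j,\mathbb{C}X)}$. Put $\overline{u}=\frac{1}{|X|}\sum_{x\in X}e_x$ and $\|h\|_{\rm TV}=\frac12\sum_{x\in X}|h(x)|$ for $h=\sum_x h(x)e_x\in\mathbb{C}X$. Let $Q$ be a probability distribution on $G$, let $q=\sum_{g\in G}Q(g)e_g$ be the corresponding element of the group algebra $\mathbb{C}G$ (which acts on $\mathbb{C}X$), let $\hat Q(\rho_j)=\sum_{g\in G}Q(g)[\rho_j(g)]_{B_j}$, and let $\|A\|_{\rm Fb}^2={\rm Tr}(AA^*)$. Then for every integer $N\ge 0$ there exist initial states $r$ and $s$ in $X$ such that \[\|q^N\cdot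 e_{r}-\overline{u}\|_{\rm TV}^2\leq \frac{1}{4}\sum_{V_j\neq {\rm triv}} m(V_j, \mathbb{C} X)\, \|\hat{Q}(\rho_j)^N\|_{\rm Fb}^2\] and \[\|q^N\cdot e_{s}-\overline{u}\|_{\rm TV}^2\geq \frac{1}{4|X|}\sum_{V_j\neq {\rm triv}} m(V_j, \mathbb{C} X)\, \|\hat{Q}(\rho_j)^N\|_{\rm Fb}^2,\] where the sums run over the irreducible representations $V_j$ not isomorphic to the trivial one. -/

import Mathlib

namespace HomogeneousWalk

/-- A complete list `(V j, ρ j)`, indexed by `ι`, of the irreducible complex representations of `G`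
(each isomorphism class occurring exactly once). Each `V j` carries a `G`-invariant Hermitian inner
product and a chosen basis that is orthonormal for it. -/
structure IrrepSystem.{w, u, v} (G : Type u) [Group G] (ι : Type v) where
  V : ι → Type w
  [normed : ∀ j, NormedAddCommGroup (V j)]
  [innerProd : ∀ j, InnerProductSpace ℂ (V j)]
  ρ : ∀ j, Representation ℂ G (V j)
  invariant : ∀ j g v w, Inner.inner ℂ (ρ j g v) (ρ j g w) = Inner.inner ℂ v w
  dim : ι → ℕ
  basis : ∀ j, OrthonormalBasis (Fin (dim j)) ℂ (V j)
  irreducible : ∀ j, (ρ j).IsIrreducible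
  distinct : ∀ i j, Nonempty ((ρ i).Equiv (ρ j)) → i = j
  complete : ∀ (W : Type) [AddCommGroup W] [Module ℂ W] [FiniteDimensional ℂ W]
    (σ : Representation ℂ G W), σ.IsIrreducible → ∃ j, Nonempty (σ.Equiv (ρ j))

attribute [instance] IrrepSystem.normed IrrepSystem.innerProd

namespace IrrepSystem

variable {G ι : Type*} [Group G] (S : IrrepSystem G ι)

/-- The indices of the irreducible representations not isomorphic to the trivial one. -/
def nontrivial : Set ι :=
  {j | ¬ Nonempty ((S.ρ j).Equiv (Representation.trivial ℂ G ℂ))}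

/-- `Λ` is isomorphic to the direct sum over `j` of `m j` copies of `V j`. -/
def IsDecomposition {E : Type*} [AddCommGroup E] [Module ℂ E] (Λ : Representation ℂ G E)
    (m : ι → ℕ) : Prop :=
  Nonempty (Λ.Equiv (Representation.directSum fun p : Σ j, Fin (m j) => S.ρ p.1))

open Classical in
/-- The multiplicities `m(V j, Λ)`: the integers `m j` with `Λ ≅ ⨁ j, (V j) ^ (m j)`. For a
finite group `G` and a finite-dimensional `Λ` they exist and are unique (complete reducibility);
the value `0` is a placeholder for the other case. -/
noncomputable def multiplicity {E : Type*} [AddCommGroup E] [Module ℂ E]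
    (Λ : Representation ℂ G E) : ι → ℕ :=
  if h : ∃ m, S.IsDecomposition Λ m then h.choose else 0

/-- The Fourier transform of `Q` at `ρ j`, a matrix in the chosen orthonormal basis of `V j`. -/
noncomputable def fourier [Fintype G] (Q : G → ℂ) (j : ι) :
    Matrix (Fin (S.dim j)) (Fin (S.dim j)) ℂ :=
  ∑ g, Q g • LinearMap.toMatrix (S.basis j).toBasis (S.basis j).toBasis (S.ρ j g)

/-- A finite group has only finitely many irreducible representations, so that sums over `ι` are
finite sums. -/
theorem finite_index {G ι : Type*} [Group G] [Finite G] (S : IrrepSystem G ι) : Finite ι := by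
  classical
  cases nonempty_fintype G
  have hcard : (Nat.card G : ℂ) ≠ 0 := by exact_mod_cast Nat.card_pos.ne'
  let _ : Invertible (Nat.card G : ℂ) := invertibleOfNonzero hcard
  have hfin : ∀ j, FiniteDimensional ℂ (S.V j) := fun j =>
    Module.Finite.of_basis (S.basis j).toBasis
  have hirr := S.irreducible
  have orth : ∀ i j, (Nat.card G : ℂ)⁻¹ * ∑ g : G, (S.ρ i).character g * (S.ρ j).character g⁻¹ =
      if i = j then 1 else 0 := by
    intro i j
    have h := Representation.char_orthonormal (S.ρ i) (S.ρ j)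
    rw [h]
    by_cases hij : i = j
    · subst hij
      rw [if_pos ⟨Representation.Equiv.refl _⟩, if_pos rfl]
    · rw [if_neg (fun hn => hij (S.distinct j i hn).symm), if_neg hij]
  have hli : LinearIndependent ℂ (fun j => (S.ρ j).character) := by
    rw [linearIndependent_iff']
    intro s c hc j hj
    have h0 : (Nat.card G : ℂ)⁻¹ * ∑ g : G,
        (∑ i ∈ s, c i • (S.ρ i).character) g * (S.ρ j).character g⁻¹ = 0 := by
      rw [hc]; simp
    have h1 : (Nat.card G : ℂ)⁻¹ * ∑ g : G,
        (∑ i ∈ s, c i • (S.ρ i).character) g * (S.ρ j).character g⁻¹ =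
        ∑ i ∈ s, c i * ((Nat.card G : ℂ)⁻¹ *
          ∑ g : G, (S.ρ i).character g * (S.ρ j).character g⁻¹) := by
      simp only [Finset.sum_apply, Pi.smul_apply, smul_eq_mul, Finset.sum_mul, Finset.mul_sum]
      rw [Finset.sum_comm]
      refine Finset.sum_congr rfl fun i _ => Finset.sum_congr rfl fun g _ => by ring
    rw [h1] at h0
    simp only [orth] at h0
    simpa [hj] using h0
  exact hli.finite

end IrrepSystem

/-- The squared Frobenius norm `Tr (A A*)`, a real number. -/
noncomputable def frobSq {n : ℕ} (A : Matrix (Fin n) (Fin n) ℂ) : ℝ :=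
  (A * A.conjTranspose).trace.re

/-- The element `∑ g, Q g • e_g` of the group algebra. -/
noncomputable def groupElem {G : Type*} [Fintype G] (Q : G → ℂ) : MonoidAlgebra ℂ G :=
  ∑ g, MonoidAlgebra.single g (Q g)

/-- The permutation representation `ℂX`: the space with basis `e_x = single x 1`, on which
`g • e_x = e_{g • x}`. -/
noncomputable abbrev permRep (G X : Type*) [Group G] [MulAction G X] :
    Representation ℂ G (MonoidAlgebra ℂ X) :=
  Representation.ofMulAction ℂ G X

/-- The basis vector `e_x` of `ℂX`. -/
noncomputable def e {X : Type*} (x : X) : MonoidAlgebra ℂ X := MonoidAlgebra.single x 1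

/-- The action `a · v` of the group algebra on `ℂX`. -/
noncomputable def act {G X : Type*} [Group G] [MulAction G X] (a : MonoidAlgebra ℂ G)
    (v : MonoidAlgebra ℂ X) : MonoidAlgebra ℂ X :=
  (permRep G X).asAlgebraHom a v

/-- The element of `ℂX` that represents the uniform distribution. -/
noncomputable def unif (X : Type*) [Fintype X] : MonoidAlgebra ℂ X :=
  (1 / (Fintype.card X : ℂ)) • ∑ x, e x

/-- The total variation norm on `ℂX`. -/
noncomputable def tvNorm {X : Type*} [Fintype X] (h : MonoidAlgebra ℂ X) : ℝ :=
  (1 / 2) * ∑ x, ‖h.coeff x‖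

end HomogeneousWalk

/-! Replace the ℓ¹ distance to uniform by the ℓ² one and sum its square over all starting states.
Each start x contributes ‖q^N e_x‖² - 1/|X|, so the sum is Tr(q^N (q^N)*) - 1 on ℂX. In a basis
where G acts by unitary matrices, a squared Frobenius norm is the trace of the algebra element `a *
adjoint a`, which depends only on the isomorphism class. Splitting ℂX into irreducibles therefore
turns the sum into ∑ m_j ‖Q̂(ρ_j)^N‖² - 1. By transitivity the trivial representation occurs once,
and it contributes exactly 1, cancelling the -1 (`finsum_nontrivial_eq`). The best start lies below
the average and the worst above it; comparing ℓ¹ with ℓ² gives the two constants. -/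

namespace Representation

/-- A `G`-equivariant `k`-linear equivalence from a `k[G]`-module to a representation is
`k[G]`-linear. -/
noncomputable def asModuleEquivOfLinearEquiv {k G N W : Type*} [Field k] [Group G]
    [AddCommGroup N] [Module k N] [Module (MonoidAlgebra k G) N]
    [IsScalarTower k (MonoidAlgebra k G) N] [AddCommGroup W] [Module k W]
    (τ : Representation k G W) (b : N ≃ₗ[k] W)
    (hb : ∀ g x, b (MonoidAlgebra.single g (1 : k) • x) = τ g (b x)) :
    N ≃ₗ[MonoidAlgebra k G] τ.asModule :=
  { (b.trans τ.asModuleEquiv.symm).toAddEquiv with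
    map_smul' := fun r x => by
      change τ.asModuleEquiv.symm (b (r • x)) = r • τ.asModuleEquiv.symm (b x)
      apply τ.asModuleEquiv.injective
      rw [asModuleEquiv_map_smul, LinearEquiv.apply_symm_apply, LinearEquiv.apply_symm_apply]
      induction r using MonoidAlgebra.induction_linear with
      | zero => simp
      | add p q hp hq => rw [add_smul, map_add, hp, hq, map_add, LinearMap.add_apply]
      | single g c =>
        have h : MonoidAlgebra.single g c = c • MonoidAlgebra.single g (1 : k) := by simp
        rw [h, smul_assoc, map_smul, hb, map_smul, asAlgebraHom_single_one, LinearMap.smul_apply] }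

/-- The trace of a direct sum of endomorphisms of finite-dimensional spaces. -/
theorem trace_directSum_lmap {k κ : Type*} [Field k] [Fintype κ] {V : κ → Type*}
    [∀ i, AddCommGroup (V i)] [∀ i, Module k (V i)] [∀ i, FiniteDimensional k (V i)]
    (f : ∀ i, V i →ₗ[k] V i) :
    LinearMap.trace k _ (DirectSum.lmap f) = ∑ i, LinearMap.trace k (V i) (f i) := by
  classical
  let b := fun i => Module.finBasis k (V i)
  let B : Module.Basis (Σ i, Fin (Module.finrank k (V i))) k (DirectSum κ V) := DFinsupp.basis b
  rw [LinearMap.trace_eq_matrix_trace k B]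
  simp_rw [fun i => LinearMap.trace_eq_matrix_trace k (b i) (f i)]
  simp only [Matrix.trace, Matrix.diag_apply, Fintype.sum_sigma, LinearMap.toMatrix_apply]
  refine Finset.sum_congr rfl fun i _ => Finset.sum_congr rfl fun x _ => ?_
  have h : B ⟨i, x⟩ = DirectSum.lof k κ V i (b i x) := by
    apply B.repr.injective
    ext ⟨j, y⟩
    rw [Module.Basis.repr_self]
    change _ = (b j).repr (DFinsupp.single i (b i x) j) y
    by_cases hij : i = j
    · subst hij
      simp [Finsupp.single_apply]
    · simp [hij, DFinsupp.single_apply]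
  rw [h, DirectSum.lmap_lof]
  change (b i).repr (DFinsupp.single i (f i (b i x)) i) x = _
  simp

theorem character_directSum {k G κ : Type*} [Field k] [Group G] [Fintype κ] {V : κ → Type*}
    [∀ i, AddCommGroup (V i)] [∀ i, Module k (V i)] [∀ i, FiniteDimensional k (V i)]
    (ρ : ∀ i, Representation k G (V i)) (g : G) :
    (directSum ρ).character g = ∑ i, (ρ i).character g :=
  trace_directSum_lmap fun i => ρ i g

/-- Every element of the group algebra acts with trace given by the character. -/
theorem trace_asAlgebraHom {k G E : Type*} [Field k] [Group G] [Fintype G] [AddCommGroup E]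
    [Module k E] (σ : Representation k G E) (a : MonoidAlgebra k G) :
    LinearMap.trace k E (σ.asAlgebraHom a) = ∑ g, a.coeff g * σ.character g := by
  induction a using MonoidAlgebra.induction_linear with
  | zero => simp
  | add p q hp hq => simp [hp, hq, add_mul, Finset.sum_add_distrib]
  | single g c =>
    classical
    simp [MonoidAlgebra.coeff_single, Finsupp.single_apply, character]

end Representation

/-! ### Complete reducibility and multiplicities -/

namespace HomogeneousWalk.IrrepSystem

open Representation

variable {G ι : Type*} [Group G] [Fintype G] (S : IrrepSystem G ι)

omit [Fintype G] in
include S in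
theorem exists_equiv_of_isSimpleModule {N : Type*} [AddCommGroup N] [Module ℂ N]
    [Module (MonoidAlgebra ℂ G) N] [IsScalarTower ℂ (MonoidAlgebra ℂ G) N]
    [FiniteDimensional ℂ N] [IsSimpleModule (MonoidAlgebra ℂ G) N] :
    ∃ j, ∃ φ : N ≃ₗ[ℂ] S.V j,
      ∀ g x, φ (MonoidAlgebra.single g (1 : ℂ) • x) = S.ρ j g (φ x) := by
  -- `complete` only covers spaces in `Type`, so the action is transported to ℂⁿ.
  let b : N ≃ₗ[ℂ] (Fin (Module.finrank ℂ N) → ℂ) := (Module.finBasis ℂ N).equivFun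
  let τ : Representation ℂ G (Fin (Module.finrank ℂ N) → ℂ) :=
    ((b.conjAlgEquiv ℂ).toMulEquiv.toMonoidHom).comp (ofModule' N)
  have hb : ∀ g x, b (MonoidAlgebra.single g (1 : ℂ) • x) = τ g (b x) := by
    intro g x
    simp [τ, ofModule', LinearEquiv.conjAlgEquiv_apply]
  have hτ : τ.IsIrreducible := by
    rw [irreducible_iff_isSimpleModule_asModule]
    exact IsSimpleModule.congr (asModuleEquivOfLinearEquiv τ b hb).symm
  obtain ⟨j, ⟨ψ⟩⟩ := S.complete _ τ hτ
  refine ⟨j, b.trans ψ.toLinearEquiv, fun g x => ?_⟩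
  have h := LinearMap.congr_fun (ψ.toIntertwiningMap.isIntertwining' g) (b x)
  change ψ.toLinearEquiv (b _) = _
  rw [hb]
  exact h

/-- Complete reducibility: every finite-dimensional representation has a decomposition. -/
theorem exists_isDecomposition {E : Type*} [AddCommGroup E] [Module ℂ E] [FiniteDimensional ℂ E]
    (σ : Representation ℂ G E) : ∃ m, S.IsDecomposition σ m := by
  classical
  -- Maschke's theorem needs |G| to be nonzero in ℂ.
  have : NeZero (Nat.card G : ℂ) := ⟨by exact_mod_cast Nat.card_pos.ne'⟩
  have : Module.Finite (MonoidAlgebra ℂ G) σ.asModule :=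
    Module.Finite.of_restrictScalars_finite ℂ _ _
  obtain ⟨n, N, e, hN⟩ := IsSemisimpleModule.exists_linearEquiv_fin_dfinsupp
    (MonoidAlgebra ℂ G) σ.asModule
  have hfd : ∀ i, FiniteDimensional ℂ (N i) := fun i =>
    FiniteDimensional.of_injective ((N i).subtype.restrictScalars ℂ) Subtype.val_injective
  have hex := fun i => S.exists_equiv_of_isSimpleModule (N := N i)
  choose f φ hφ using hex
  -- The multiplicity of j is the number of simple summands of type j; `h` regroups the summands by
  -- type.
  let m : ι → ℕ := fun j => Fintype.card {i // f i = j}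
  let h : (Σ j, Fin (m j)) ≃ Fin n :=
    (Equiv.sigmaCongrRight fun j => (Fintype.equivFin {i // f i = j}).symm).trans
      (Equiv.sigmaFiberEquiv f)
  have hf : ∀ p, f (h p) = p.1 := fun p => ((Fintype.equivFin {i // f i = p.1}).symm p.2).2
  have hψ : ∀ p, ∃ ψ : N (h p) ≃ₗ[ℂ] S.V p.1,
      ∀ g x, ψ (MonoidAlgebra.single g (1 : ℂ) • x) = S.ρ p.1 g (ψ x) := by
    intro p
    rw [← hf p]
    exact ⟨φ (h p), hφ (h p)⟩
  choose ψ hψ using hψ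
  let e₁ : E ≃ₗ[ℂ] (Π₀ i, N i) := σ.asModuleEquiv.symm.trans (e.restrictScalars ℂ)
  let e₂ : (Π₀ i, N i) ≃ₗ[ℂ] DirectSum (Σ j, Fin (m j)) fun p => N (h p) :=
    DirectSum.lequivCongrLeft ℂ h.symm
  let e₃ : (DirectSum (Σ j, Fin (m j)) fun p => N (h p)) ≃ₗ[ℂ]
    DirectSum (Σ j, Fin (m j)) fun p => S.V p.1 := DFinsupp.mapRange.linearEquiv ψ
  refine ⟨m, ⟨Representation.Equiv.mk (e₁.trans (e₂.trans e₃)) fun g => LinearMap.ext fun x => ?_⟩⟩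
  refine DFinsupp.ext fun p => ?_
  have key : ∀ y p, (e₁.trans (e₂.trans e₃) y) p = ψ p ((e (σ.asModuleEquiv.symm y)) (h p)) :=
    fun y p => rfl
  have h1 : σ.asModuleEquiv.symm (σ g x) =
      MonoidAlgebra.single g (1 : ℂ) • σ.asModuleEquiv.symm x := asModuleEquiv_symm_map_rho σ g x
  change (e₁.trans (e₂.trans e₃) (σ g x)) p = S.ρ p.1 g ((e₁.trans (e₂.trans e₃) x) p)
  rw [key, key, h1, map_smul, ← hψ]
  rfl

theorem multiplicity_spec {E : Type*} [AddCommGroup E] [Module ℂ E] [FiniteDimensional ℂ E]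
    (σ : Representation ℂ G E) : S.IsDecomposition σ (S.multiplicity σ) := by
  have h := S.exists_isDecomposition σ
  rw [multiplicity, dif_pos h]
  exact h.choose_spec

instance finiteDimensional_V (j : ι) : FiniteDimensional ℂ (S.V j) :=
  Module.Finite.of_basis (S.basis j).toBasis

theorem character_eq_sum_multiplicity [Fintype ι] {E : Type*} [AddCommGroup E] [Module ℂ E]
    [FiniteDimensional ℂ E] (σ : Representation ℂ G E) (g : G) :
    σ.character g = ∑ j, (S.multiplicity σ j : ℂ) * (S.ρ j).character g := by
  obtain ⟨φ⟩ := S.multiplicity_spec σ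
  rw [char_iso φ, character_directSum, Fintype.sum_sigma]
  exact Finset.sum_congr rfl fun j _ => by
    change ∑ _i : Fin (S.multiplicity σ j), (S.ρ j).character g = _
    rw [Finset.sum_const, Finset.card_univ, Fintype.card_fin, nsmul_eq_mul]

theorem trace_eq_sum_multiplicity [Fintype ι] {E : Type*} [AddCommGroup E] [Module ℂ E]
    [FiniteDimensional ℂ E] (σ : Representation ℂ G E) (a : MonoidAlgebra ℂ G) :
    LinearMap.trace ℂ E (σ.asAlgebraHom a) =
      ∑ j, (S.multiplicity σ j : ℂ) * LinearMap.trace ℂ (S.V j) ((S.ρ j).asAlgebraHom a) := by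
  simp_rw [trace_asAlgebraHom, S.character_eq_sum_multiplicity σ, Finset.mul_sum]
  rw [Finset.sum_comm]
  exact Finset.sum_congr rfl fun j _ => Finset.sum_congr rfl fun g _ => by ring

end HomogeneousWalk.IrrepSystem

/-! ### Frobenius norms as traces, and the walk on X -/

namespace HomogeneousWalk

open Representation

/-- The adjoint `∑ g, conj (a g) • e_{g⁻¹}` of an element of the group algebra. -/
noncomputable def adjoint {G : Type*} [Group G] [Fintype G] (a : MonoidAlgebra ℂ G) :
    MonoidAlgebra ℂ G :=
  ∑ g, MonoidAlgebra.single g⁻¹ (star (a.coeff g))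

theorem asAlgebraHom_eq_sum {G E : Type*} [Group G] [Fintype G] [AddCommGroup E] [Module ℂ E]
    (σ : Representation ℂ G E) (a : MonoidAlgebra ℂ G) :
    σ.asAlgebraHom a = ∑ g, a.coeff g • σ g := by
  have h : a = ∑ g, MonoidAlgebra.single g (a.coeff g) := by
    classical
    ext x
    simp [MonoidAlgebra.coeff_sum, MonoidAlgebra.coeff_single]
  conv_lhs => rw [h]
  simp

/-- Unitarity `hb` makes the conjugate transpose the matrix of `adjoint a`, so the norm becomes a
basis-free trace. -/
theorem trace_mul_conjTranspose_toMatrix {G E n : Type*} [Group G] [Fintype G] [AddCommGroup E]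
    [Module ℂ E] [Fintype n] [DecidableEq n] (σ : Representation ℂ G E) (b : Module.Basis n ℂ E)
    (hb : ∀ g, (LinearMap.toMatrix b b (σ g)).conjTranspose = LinearMap.toMatrix b b (σ g⁻¹))
    (a : MonoidAlgebra ℂ G) :
    (LinearMap.toMatrix b b (σ.asAlgebraHom a) *
      (LinearMap.toMatrix b b (σ.asAlgebraHom a)).conjTranspose).trace =
      LinearMap.trace ℂ E (σ.asAlgebraHom (a * adjoint a)) := by
  have h : (LinearMap.toMatrix b b (σ.asAlgebraHom a)).conjTranspose =
      LinearMap.toMatrix b b (σ.asAlgebraHom (adjoint a)) := by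
    rw [asAlgebraHom_eq_sum, adjoint]
    simp only [map_sum, map_smul, Matrix.conjTranspose_sum, Matrix.conjTranspose_smul, hb,
      asAlgebraHom_single]
  rw [h, map_mul, ← LinearMap.toMatrix_mul, LinearMap.trace_eq_matrix_trace ℂ b]

/-- The basis `(e_x)` of `ℂX`. -/
noncomputable def permBasis (X : Type*) : Module.Basis X ℂ (MonoidAlgebra ℂ X) :=
  Module.Basis.ofRepr (MonoidAlgebra.coeffLinearEquiv ℂ)

theorem permBasis_apply {X : Type*} (x : X) : permBasis X x = e x := rfl

theorem permBasis_repr {X : Type*} (v : MonoidAlgebra ℂ X) (x : X) :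
    (permBasis X).repr v x = v.coeff x := rfl

instance {X : Type*} [Fintype X] : FiniteDimensional ℂ (MonoidAlgebra ℂ X) :=
  Module.Finite.of_basis (permBasis X)

theorem trace_mul_conjTranspose_re {n : Type*} [Fintype n] (A : Matrix n n ℂ) :
    (A * A.conjTranspose).trace.re = ∑ i, ∑ j, ‖A i j‖ ^ 2 := by
  simp only [Matrix.trace, Matrix.diag_apply, Matrix.mul_apply, Matrix.conjTranspose_apply,
    Complex.star_def, Complex.mul_conj, Complex.re_sum, Complex.ofReal_re,
    Complex.normSq_eq_norm_sq]

section Walk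

variable {G X : Type*} [Group G] [Fintype G] [Fintype X] [MulAction G X]

theorem sum_norm_sq_act (a : MonoidAlgebra ℂ G) :
    ∑ y : X, ∑ x : X, ‖(act a (e x)).coeff y‖ ^ 2 =
      (LinearMap.trace ℂ _ ((permRep G X).asAlgebraHom (a * adjoint a))).re := by
  classical
  rw [← trace_mul_conjTranspose_toMatrix _ (permBasis X), trace_mul_conjTranspose_re]
  · refine Finset.sum_congr rfl fun y _ => Finset.sum_congr rfl fun x _ => ?_
    rw [LinearMap.toMatrix_apply, permBasis_apply, permBasis_repr, act]
  -- Permutation matrices are unitary.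
  · intro g
    ext y x
    simp only [Matrix.conjTranspose_apply, LinearMap.toMatrix_apply, permBasis_apply,
      permBasis_repr, e, permRep, ofMulAction_single, MonoidAlgebra.coeff_single,
      Finsupp.single_apply, inv_smul_eq_iff]
    by_cases h : g • y = x
    · simp [h]
    · simp [h, Ne.symm h]

/-- A probability measure on `G` preserves total mass. -/
theorem sum_coeff_act_pow {Q : G → ℂ} (hQ : ∑ g, Q g = 1) (N : ℕ) (v : MonoidAlgebra ℂ X) :
    ∑ y, (act (groupElem Q ^ N) v).coeff y = ∑ y, v.coeff y := by
  induction N generalizing v with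
  | zero => simp [act]
  | succ N ih =>
    have h : act (groupElem Q ^ (N + 1)) v = act (groupElem Q ^ N) (act (groupElem Q) v) := by
      simp [act, pow_succ]
    rw [h, ih]
    have h2 : act (groupElem Q) v = ∑ g, Q g • permRep G X g v := by
      simp [act, groupElem]
    simp only [h2, MonoidAlgebra.coeff_sum, Finsupp.coe_finsetSum, Finset.sum_apply,
      MonoidAlgebra.coeff_smul, Finsupp.smul_apply, smul_eq_mul, coeff_ofMulAction]
    rw [Finset.sum_comm]
    simp_rw [← Finset.mul_sum]
    have h3 : ∀ g : G, ∑ y, v.coeff (g⁻¹ • y) = ∑ y, v.coeff y := fun g =>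
      Equiv.sum_comp (MulAction.toPerm g⁻¹) fun y => v.coeff y
    simp_rw [h3, ← Finset.sum_mul, hQ, one_mul]

theorem coeff_unif (y : X) : (unif X).coeff y = 1 / (Fintype.card X : ℂ) := by
  classical
  simp [unif, e, MonoidAlgebra.coeff_sum, MonoidAlgebra.coeff_smul, MonoidAlgebra.coeff_single,
    Finsupp.single_apply]

/-- Pythagoras: total mass 1 makes v - u orthogonal to the uniform vector u, and ‖u‖² = 1/|X|. -/
theorem sum_norm_sub_sq {v : X → ℂ} (hv : ∑ y, v y = 1) :
    ∑ y, ‖v y - 1 / (Fintype.card X : ℂ)‖ ^ 2 =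
      ∑ y, ‖v y‖ ^ 2 - 1 / (Fintype.card X : ℝ) := by
  have hX : (Fintype.card X : ℝ) ≠ 0 := by
    intro h
    have : IsEmpty X := Fintype.card_eq_zero_iff.mp (by exact_mod_cast h)
    simp at hv
  have hre : ∑ y, (v y).re = 1 := by
    simpa using congrArg Complex.re hv
  have h : ∀ y, ‖v y - 1 / (Fintype.card X : ℂ)‖ ^ 2 =
      ‖v y‖ ^ 2 - 2 / (Fintype.card X : ℝ) * (v y).re + (1 / (Fintype.card X : ℝ)) ^ 2 := by
    intro y
    have hc : (1 / (Fintype.card X : ℂ)) = ((1 / (Fintype.card X : ℝ) : ℝ) : ℂ) := by push_cast; rfl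
    rw [hc, ← Complex.normSq_eq_norm_sq, ← Complex.normSq_eq_norm_sq, Complex.normSq_apply,
      Complex.normSq_apply, Complex.sub_re, Complex.sub_im, Complex.ofReal_re, Complex.ofReal_im]
    ring
  simp_rw [h, Finset.sum_add_distrib, Finset.sum_sub_distrib, ← Finset.mul_sum, hre]
  simp only [Finset.sum_const, Finset.card_univ, nsmul_eq_mul]
  field_simp
  ring

theorem sum_norm_act_pow_sub_unif [Nonempty X] {Q : G → ℂ} (hQ : ∑ g, Q g = 1) (N : ℕ) :
    ∑ x : X, ∑ y, ‖(act (groupElem Q ^ N) (e x) - unif X).coeff y‖ ^ 2 =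
      (LinearMap.trace ℂ _ ((permRep G X).asAlgebraHom
        (groupElem Q ^ N * adjoint (groupElem Q ^ N)))).re - 1 := by
  have hX : (Fintype.card X : ℝ) ≠ 0 := by exact_mod_cast Fintype.card_ne_zero
  have h : ∀ x : X, ∑ y, (act (groupElem Q ^ N) (e x)).coeff y = 1 := fun x => by
    classical
    rw [sum_coeff_act_pow hQ]
    simp [e, MonoidAlgebra.coeff_single, Finsupp.single_apply]
  simp only [MonoidAlgebra.coeff_sub, Finsupp.sub_apply, coeff_unif]
  simp_rw [sum_norm_sub_sq (h _)]
  rw [← sum_norm_sq_act, Finset.sum_sub_distrib, Finset.sum_comm]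
  simp [hX]

omit [Fintype G] in
/-- For a transitive action, the invariants of `ℂX` are spanned by one vector. -/
theorem finrank_invariants_permRep [Nonempty X] [MulAction.IsPretransitive G X] :
    Module.finrank ℂ (invariants (permRep G X)) = 1 := by
  -- By transitivity, the invariant vectors are the constant functions.
  have hu : ∀ (v : MonoidAlgebra ℂ X), v ∈ invariants (permRep G X) ↔
      ∀ x y, v.coeff x = v.coeff y := by
    intro v
    rw [mem_invariants]
    constructor
    · intro hv x y
      obtain ⟨g, hg⟩ := MulAction.exists_smul_eq G x y
      have h := congrArg (fun w => w.coeff y) (hv g)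
      simpa only [coeff_ofMulAction, ← hg, inv_smul_smul] using h
    · intro hv g
      ext y
      rw [coeff_ofMulAction]
      exact hv _ _
  obtain ⟨x₀⟩ := ‹Nonempty X›
  have hmem : unif X ∈ invariants (permRep G X) := (hu _).2 fun x y => by
    rw [coeff_unif, coeff_unif]
  have : Nonempty X := ⟨x₀⟩
  have hX : (Fintype.card X : ℂ) ≠ 0 := by exact_mod_cast Fintype.card_ne_zero
  refine finrank_eq_one (⟨unif X, hmem⟩ : invariants (permRep G X)) ?_ ?_
  · intro h
    have h2 := congrArg (fun w : invariants (permRep G X) => w.1.coeff x₀) h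
    simp [coeff_unif] at h2
  · rintro ⟨v, hv⟩
    refine ⟨Fintype.card X * v.coeff x₀, Subtype.ext ?_⟩
    ext y
    simp only [MonoidAlgebra.coeff_smul, Submodule.coe_smul, Finsupp.smul_apply, coeff_unif,
      smul_eq_mul, (hu v).1 hv y x₀]
    field_simp

end Walk

/-! ### The Fourier side and the trivial representation -/

namespace IrrepSystem

variable {G ι : Type*} [Group G] [Fintype G] (S : IrrepSystem G ι)

omit [Fintype G] in
theorem toMatrix_conjTranspose (j : ι) (g : G) :
    (LinearMap.toMatrix (S.basis j).toBasis (S.basis j).toBasis (S.ρ j g)).conjTranspose =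
      LinearMap.toMatrix (S.basis j).toBasis (S.basis j).toBasis (S.ρ j g⁻¹) := by
  ext k l
  simp only [Matrix.conjTranspose_apply, LinearMap.toMatrix_apply, OrthonormalBasis.coe_toBasis,
    OrthonormalBasis.coe_toBasis_repr_apply, OrthonormalBasis.repr_apply_apply]
  rw [← S.invariant j g (S.basis j k) (S.ρ j g⁻¹ _), self_inv_apply]
  exact inner_conj_symm _ _

theorem fourier_pow (Q : G → ℂ) (j : ι) (N : ℕ) :
    S.fourier Q j ^ N = LinearMap.toMatrix (S.basis j).toBasis (S.basis j).toBasis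
      ((S.ρ j).asAlgebraHom (groupElem Q ^ N)) := by
  rw [map_pow, ← LinearMap.toMatrix_pow]
  congr 1
  simp [fourier, groupElem]

theorem frobSq_fourier_pow (Q : G → ℂ) (j : ι) (N : ℕ) :
    frobSq (S.fourier Q j ^ N) = (LinearMap.trace ℂ (S.V j) ((S.ρ j).asAlgebraHom
      (groupElem Q ^ N * adjoint (groupElem Q ^ N)))).re := by
  rw [frobSq, fourier_pow, trace_mul_conjTranspose_toMatrix _ _ (S.toMatrix_conjTranspose j)]

omit [Fintype G] in
include S in
theorem exists_equiv_trivial : ∃ j, Nonempty ((S.ρ j).Equiv (Representation.trivial ℂ G ℂ)) := by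
  have h : (Representation.trivial ℂ G ℂ).IsIrreducible := by
    have : Nontrivial (Subrepresentation (Representation.trivial ℂ G ℂ)) :=
      ⟨⊥, ⊤, fun h => by
        have h2 := congrArg Subrepresentation.toSubmodule h
        exact bot_ne_top (α := Submodule ℂ ℂ) h2⟩
    refine ⟨fun a => ?_⟩
    rcases eq_bot_or_eq_top (α := Submodule ℂ ℂ) a.toSubmodule with h | h
    · exact Or.inl (Subrepresentation.toSubmodule_injective h)
    · exact Or.inr (Subrepresentation.toSubmodule_injective h)
  obtain ⟨j, ⟨φ⟩⟩ := S.complete ℂ _ h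
  exact ⟨j, ⟨φ.symm⟩⟩

omit [Fintype G] in
theorem ρ_eq_one_of_equiv_trivial {j : ι}
    (φ : (S.ρ j).Equiv (Representation.trivial ℂ G ℂ)) (g : G) : S.ρ j g = 1 := by
  ext x
  apply φ.toLinearEquiv.injective
  exact LinearMap.congr_fun (φ.toIntertwiningMap.isIntertwining' g) x

theorem frobSq_fourier_pow_trivial {j : ι}
    (φ : (S.ρ j).Equiv (Representation.trivial ℂ G ℂ)) {Q : G → ℂ} (hQ : ∑ g, Q g = 1) (N : ℕ) :
    frobSq (S.fourier Q j ^ N) = 1 := by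
  have h : S.fourier Q j = 1 := by
    simp only [fourier, S.ρ_eq_one_of_equiv_trivial φ, LinearMap.toMatrix_one, ← Finset.sum_smul,
      hQ, one_smul]
  have hd : S.dim j = 1 := by
    have h1 := Module.finrank_eq_card_basis (S.basis j).toBasis
    rw [φ.toLinearEquiv.finrank_eq] at h1
    simpa using h1.symm
  simp [h, frobSq, hd]

/-- Averaging the character of σ over G gives the dimension of its invariants; by orthogonality with
the trivial character, only the summands of type j survive the average. -/
theorem multiplicity_trivial [Fintype ι] {j : ι}
    (φ : (S.ρ j).Equiv (Representation.trivial ℂ G ℂ)) {E : Type*} [AddCommGroup E] [Module ℂ E]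
    [FiniteDimensional ℂ E] (σ : Representation ℂ G E) :
    S.multiplicity σ j = Module.finrank ℂ (invariants σ) := by
  classical
  have hcard : (Nat.card G : ℂ) ≠ 0 := by exact_mod_cast Nat.card_pos.ne'
  let _ : Invertible (Nat.card G : ℂ) := invertibleOfNonzero hcard
  have hirr := S.irreducible
  have hav : ∀ i, (Nat.card G : ℂ)⁻¹ * ∑ g, (S.ρ i).character g = if i = j then 1 else 0 := by
    intro i
    have h := char_orthonormal (S.ρ i) (S.ρ j)
    have hone : ∀ g, (S.ρ j).character g = 1 := fun g => by
      rw [character, S.ρ_eq_one_of_equiv_trivial φ, LinearMap.trace_one,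
        φ.toLinearEquiv.finrank_eq]
      simp
    simp_rw [hone, mul_one] at h
    rw [h]
    by_cases hij : i = j
    · subst hij
      rw [if_pos ⟨Representation.Equiv.refl _⟩, if_pos rfl]
    · rw [if_neg (fun hn => hij (S.distinct j i hn).symm), if_neg hij]
  have h := card_inv_mul_sum_char_eq_finrank σ
  simp_rw [S.character_eq_sum_multiplicity σ] at h
  rw [Finset.sum_comm] at h
  simp_rw [← Finset.mul_sum] at h
  rw [Finset.mul_sum] at h
  simp_rw [mul_left_comm _ (S.multiplicity σ _ : ℂ), hav] at h
  simp only [mul_ite, mul_one, mul_zero, Finset.sum_ite_eq', Finset.mem_univ, if_true] at h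
  exact_mod_cast h

theorem finsum_nontrivial_eq {X : Type*} [Fintype X] [Nonempty X] [MulAction G X]
    [MulAction.IsPretransitive G X] {Q : G → ℂ} (hQ : ∑ g, Q g = 1) (N : ℕ) :
    ∑ᶠ j ∈ S.nontrivial, (S.multiplicity (permRep G X) j : ℝ) * frobSq (S.fourier Q j ^ N) =
      ∑ x : X, ∑ y, ‖(act (groupElem Q ^ N) (e x) - unif X).coeff y‖ ^ 2 := by
  classical
  have := S.finite_index
  cases nonempty_fintype ι
  obtain ⟨j₀, ⟨φ⟩⟩ := S.exists_equiv_trivial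
  have hset : S.nontrivial = ↑(Finset.univ.erase j₀) := by
    ext j
    simp only [nontrivial, Set.mem_ofPred_eq, Finset.coe_erase, Finset.coe_univ, Set.mem_sdiff,
      Set.mem_univ, true_and, Set.mem_singleton_iff]
    refine not_congr ⟨fun ⟨ψ⟩ => S.distinct _ _ ⟨ψ.trans φ.symm⟩, ?_⟩
    rintro rfl
    exact ⟨φ⟩
  rw [hset, finsum_mem_coe_finset, sum_norm_act_pow_sub_unif hQ,
    S.trace_eq_sum_multiplicity (permRep G X), Complex.re_sum,
    ← Finset.add_sum_erase _ _ (Finset.mem_univ j₀)]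
  have h : ∀ j, ((S.multiplicity (permRep G X) j : ℂ) * LinearMap.trace ℂ (S.V j)
      ((S.ρ j).asAlgebraHom (groupElem Q ^ N * adjoint (groupElem Q ^ N)))).re =
      (S.multiplicity (permRep G X) j : ℝ) * frobSq (S.fourier Q j ^ N) := fun j => by
    rw [frobSq_fourier_pow, ← Complex.ofReal_natCast, Complex.re_ofReal_mul]
  simp_rw [h]
  rw [S.multiplicity_trivial φ, finrank_invariants_permRep, S.frobSq_fourier_pow_trivial φ hQ]
  simp

end IrrepSystem

/-! ### Comparison of norms and conclusion -/

theorem tvNorm_sq_le {X : Type*} [Fintype X] (h : MonoidAlgebra ℂ X) :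
    tvNorm h ^ 2 ≤ 1 / 4 * (Fintype.card X * ∑ y, ‖h.coeff y‖ ^ 2) := by
  have := sq_sum_le_card_mul_sum_sq (s := Finset.univ) (f := fun y => ‖h.coeff y‖)
  rw [tvNorm, mul_pow, Finset.card_univ] at *
  linarith

theorem le_tvNorm_sq {X : Type*} [Fintype X] (h : MonoidAlgebra ℂ X) :
    1 / 4 * ∑ y, ‖h.coeff y‖ ^ 2 ≤ tvNorm h ^ 2 := by
  have := Finset.sum_sq_le_sq_sum_of_nonneg (s := Finset.univ) (f := fun y => ‖h.coeff y‖)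
    fun _ _ => norm_nonneg _
  rw [tvNorm, mul_pow]
  linarith

end HomogeneousWalk

open HomogeneousWalk in
theorem mainTheorem6 {G X ι : Type*} [Group G] [Fintype G] [Fintype X] [Nonempty X]
    [MulAction G X] [MulAction.IsPretransitive G X] (S : IrrepSystem G ι)
    (Q : G → ℝ) (hQ_nonneg : ∀ g, 0 ≤ Q g) (hQ_sum : ∑ g, Q g = 1) (N : ℕ) :
    (∃ r : X, tvNorm (act (groupElem (fun g => (Q g : ℂ)) ^ N) (e r) - unif X) ^ 2 ≤
      (1 / 4) * ∑ᶠ j ∈ S.nontrivial,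
        (S.multiplicity (permRep G X) j : ℝ) * frobSq (S.fourier (fun g => (Q g : ℂ)) j ^ N)) ∧
    (∃ s : X, tvNorm (act (groupElem (fun g => (Q g : ℂ)) ^ N) (e s) - unif X) ^ 2 ≥
      (1 / (4 * (Fintype.card X : ℝ))) * ∑ᶠ j ∈ S.nontrivial,
        (S.multiplicity (permRep G X) j : ℝ) * frobSq (S.fourier (fun g => (Q g : ℂ)) j ^ N)) := by
  have hQ : ∑ g, (Q g : ℂ) = 1 := by exact_mod_cast hQ_sum
  have hX : (0 : ℝ) < Fintype.card X := by exact_mod_cast Fintype.card_pos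
  rw [S.finsum_nontrivial_eq hQ N]
  set D : X → ℝ := fun x =>
    ∑ y, ‖(act (groupElem (fun g => (Q g : ℂ)) ^ N) (e x) - unif X).coeff y‖ ^ 2 with hD
  constructor
  · obtain ⟨r, -, hr⟩ := Finset.exists_min_image Finset.univ D Finset.univ_nonempty
    refine ⟨r, (tvNorm_sq_le _).trans ?_⟩
    -- The minimum is at most the average, which absorbs the factor |X| from Cauchy–Schwarz.
    have h := Finset.card_nsmul_le_sum Finset.univ D (D r) hr
    rw [Finset.card_univ, nsmul_eq_mul] at h
    linarith
  · obtain ⟨s, -, hs⟩ := Finset.exists_max_image Finset.univ D Finset.univ_nonempty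
    refine ⟨s, le_trans ?_ (le_tvNorm_sq _)⟩
    -- No factor |X| arises in this comparison of norms, so the 1/|X| of the average remains in the
    -- bound.
    have h := Finset.sum_le_card_nsmul Finset.univ D (D s) hs
    rw [Finset.card_univ, nsmul_eq_mul] at h
    rw [one_div_mul_eq_div, div_le_iff₀ (by positivity)]
    linarith
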